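/- Fix an integer $\kappa\ge 0$ and let $X_0:\mathbb{N}=\{1,2,\dots\}\to\{0,1,\dots,\kappa\}$ have finite support; $X_0(x)=0$ means that site $x$ is empty, and $X_0(x)=i\ge 1$ that it holds a ball of color $i$. For $1\le a\le\kappa$ let $K_a$ be the operator that takes the balls of color $a$ one after the other, from left to right, and moves each to the leftmost empty site to its right. The $\kappa$-color box-ball trajectory $(X_t)_{t\ge 0}$ is $X_{t+1}=K_1\circ K_2\circ\cdots\circ K_\kappa(X_t)$. A soliton of length $k\ge 1$ in $X_t$ is a block of $k$ consecutive occupied sites with colors non-increasing from left to right, whose content is preserved at all later times while it moves $k$ sites to the right per time step. A soliton decomposition of the trajectory, reached at time $T$, is a partition of the balls of $X_T$ into solitons whose lengths are non-decreasing from left to right; $\lambda_1(X_0)$ denotes the length of the longest soliton in it ($0$ if there are no balls). Define the infinite-capacity carrier process $(\Gamma_s)_{s\ge 0}$ over $X_0$, a sequence of non-increasing sequences $\mathbb{N}\to\{0,\dots,\kappa\}$ with finite support, by $\Gamma_0=[0,0,\dots]$ and as follows. Put $y=X_0(s+1)$. If $y\ge 1$, then $\Gamma_{s+1}$ is obtained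 from $\Gamma_s$ by replacing the entry at position $i^*=\min\{i\ge 1:\Gamma_s(i)<y\}$ by $y$. If $y=0$, then $\Gamma_{s+1}(i)=\Gamma_s(i+1)$ for all $i\ge 1$. Then the trajectory reaches a soliton decomposition, and for every soliton decomposition that it reaches, at any time, $$\lambda_1(X_0)=\max_{s\ge 0}\bigl(\#\text{ of nonzero entries of }\Gamma_s\bigr).$$ -/

import Mathlib

/-- A `κ`-color box-ball configuration with finite support: `X x` is the color of the ball at site
`x`, and `X x = 0` means that the site is empty.  The sites `1, 2, 3, …` are numbered here from
`0`. -/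
abbrev BBSConfig (κ : ℕ) : Type := ℕ →₀ Fin (κ + 1)

namespace BBS

noncomputable section

variable {κ : ℕ}

/-- Move the ball at site `x` to the leftmost empty site to the right of `x`. -/
def moveBall (X : BBSConfig κ) (x : ℕ) : BBSConfig κ :=
  (X.erase x).update (sInf {y : ℕ | x < y ∧ X y = 0}) (X x)

/-- The list, from left to right, of the sites that hold a ball of color `a`. -/
def sitesOfColor (a : Fin (κ + 1)) (X : BBSConfig κ) : List ℕ :=
  (X.support.filter (fun x => X x = a)).sort

/-- The operator `K_a`: the balls of color `a` present in `X` are moved one after the other,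
from left to right, each to the leftmost empty site to its right. -/
def moveColor (a : Fin (κ + 1)) (X : BBSConfig κ) : BBSConfig κ :=
  (sitesOfColor a X).foldl moveBall X

/-- One time step `K_1 ∘ K_2 ∘ ⋯ ∘ K_κ` of the `κ`-color box-ball system (`K_κ` acts first). -/
def step (X : BBSConfig κ) : BBSConfig κ :=
  (List.finRange κ).foldr (fun a Y => moveColor a.succ Y) X

/-- The configuration `X_t` at time `t` of the box-ball trajectory started from `X`. -/
def trajectory (X : BBSConfig κ) (t : ℕ) : BBSConfig κ := step^[t] X

/-- The `k` consecutive sites `a, …, a + k - 1` of `X` hold a soliton of length `k`: balls of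
non-increasing positive colors, which are preserved (in length and content) by the dynamics at
all future times while they travel to the right with speed `k`. -/
structure IsSoliton (X : BBSConfig κ) (a k : ℕ) : Prop where
  pos : 0 < k
  occupied : ∀ i < k, X (a + i) ≠ 0
  nonincreasing : ∀ i j, i ≤ j → j < k → X (a + j) ≤ X (a + i)
  preserved : ∀ t, ∀ i < k, trajectory X t (a + t * k + i) = X (a + i)

/-- `X` has decomposed into the solitons listed, from left to right, in `S`; an entry `(a, k)`
of `S` stands for a soliton of length `k` whose leftmost ball is at site `a`. The solitons do not
overlap, their lengths are non-decreasing from left to right, and every ball of `X` belongs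
to one of them. -/
structure IsSolitonDecomposition (X : BBSConfig κ) (S : List (ℕ × ℕ)) : Prop where
  isSoliton : ∀ p ∈ S, IsSoliton X p.1 p.2
  ordered : S.Pairwise (fun p q => p.1 + p.2 ≤ q.1 ∧ p.2 ≤ q.2)
  covers : ∀ x, X x ≠ 0 → ∃ p ∈ S, p.1 ≤ x ∧ x < p.1 + p.2

/-- `Λ` is the Young diagram `Λ(X₀)`: at some time the trajectory started from `X₀` has reached
its soliton decomposition, and the columns of `Λ`, from left to right, are the lengths of the
solitons in non-increasing order (followed by empty columns). -/
def IsSolitonDiagram (X₀ : BBSConfig κ) (Λ : YoungDiagram) : Prop :=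
  ∃ (T : ℕ) (S : List (ℕ × ℕ)), IsSolitonDecomposition (trajectory X₀ T) S ∧
    ∀ j, Λ.colLen j = (S.map Prod.snd).reverse.getD j 0

/-- The states `𝓑_∞` of the infinite capacity carrier: non-increasing sequences of colors with
finite support. -/
structure Carrier (κ : ℕ) where
  /-- the entries, indexed from `0` -/
  entry : ℕ → Fin (κ + 1)
  antitone : Antitone entry
  finite_support : entry.support.Finite

namespace Carrier

/-- The empty carrier `[0, 0, 0, …]`. -/
def empty (κ : ℕ) : Carrier κ where
  entry _ := 0
  antitone := antitone_const
  finite_support := by simp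

/-- The position `min {i | x(i) < y}` at which a ball of color `y ≥ 1` enters the carrier. -/
def entrySite (x : Carrier κ) (y : Fin (κ + 1)) : ℕ := sInf {i : ℕ | x.entry i < y}

theorem entry_entrySite_lt (x : Carrier κ) {y : Fin (κ + 1)} (hy : y ≠ 0) :
    x.entry (x.entrySite y) < y := by
  have h : {i : ℕ | x.entry i < y}.Nonempty := by
    obtain ⟨i, hi⟩ := x.finite_support.exists_notMem
    refine ⟨i, ?_⟩
    have h0 : x.entry i = 0 := by simpa using hi
    simpa [h0] using Fin.pos_iff_ne_zero.2 hy
  exact Nat.sInf_mem h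

theorem le_entry_of_lt_entrySite (x : Carrier κ) {y : Fin (κ + 1)} {i : ℕ}
    (hi : i < x.entrySite y) : y ≤ x.entry i := by
  have h := Nat.notMem_of_lt_sInf hi
  simpa using h

/-- The carrier after a ball of color `y ≥ 1` has taken the place of the first entry smaller
than `y`. -/
def insert (x : Carrier κ) (y : Fin (κ + 1)) (hy : y ≠ 0) : Carrier κ where
  entry := Function.update x.entry (x.entrySite y) y
  antitone := by
    intro i j hij
    have hlt := x.entry_entrySite_lt hy
    rcases eq_or_ne i (x.entrySite y) with hi | hi <;>
      rcases eq_or_ne j (x.entrySite y) with hj | hj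
    · simp [hi, hj]
    · rw [Function.update_of_ne hj, hi, Function.update_self]
      exact (x.antitone (hi ▸ hij)).trans hlt.le
    · rw [Function.update_of_ne hi, hj, Function.update_self]
      exact x.le_entry_of_lt_entrySite (by omega)
    · rw [Function.update_of_ne hi, Function.update_of_ne hj]
      exact x.antitone hij
  finite_support := by
    refine (x.finite_support.insert (x.entrySite y)).subset ?_
    intro i hi
    by_cases h : i = x.entrySite y
    · exact Or.inl h
    · right
      simpa [Function.update_of_ne h] using hi

/-- The carrier after its first (largest) entry has left. -/
def shift (x : Carrier κ) : Carrier κ where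
  entry i := x.entry (i + 1)
  antitone := fun _ _ hij => x.antitone (Nat.add_le_add_right hij 1)
  finite_support := x.finite_support.preimage (Nat.succ_injective.injOn)

/-- The number of nonzero entries of the carrier. -/
def numNonzero (x : Carrier κ) : ℕ := {i : ℕ | x.entry i ≠ 0}.ncard

end Carrier

/-- The circular exclusion rule `Ψ : (x, y) ↦ (y', x')`, where `y` is the color met by the
carrier `x`, the color `y'` is dropped, and `x'` is the new state of the carrier. -/
def circularExclusion (x : Carrier κ) (y : Fin (κ + 1)) : Fin (κ + 1) × Carrier κ :=
  if hy : y = 0 then (x.entry 0, x.shift)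
  else (x.entry (x.entrySite y), x.insert y hy)

/-- The infinite capacity carrier process `Γ_0, Γ_1, Γ_2, …` over `X`, started from the empty
carrier: the transition from `Γ_s` to `Γ_{s+1}` reads the `(s+1)`-st site of `X`, whose index
here is `s`. -/
def carrierProcess (X : BBSConfig κ) : ℕ → Carrier κ
  | 0 => Carrier.empty κ
  | s + 1 => (circularExclusion (carrierProcess X s) (X s)).2

end

end BBS

/-! A single operator `K_a` is a queue swept from left to right: each ball of color `a` joins, each
empty site serves one waiting ball. Running the `κ` queues in turn is the same as running the
carrier once: at every site the load of the queue for color `a` is the number of carrier entries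
equal to `a` (`load_stage`). So the carrier drops the configuration of the next time step
(`step_apply`), and its number of nonzero entries is the total load of the queues.

The maximal load is conserved. Each queue load is a maximum of arrivals minus empty sites over
intervals ending at the site, so the total load is a maximum over paths cut into `κ` phases, one per
color. A queue load is equally a maximum over intervals to its right in the output. Trading one
formula for the other moves the first phase of a path to the end while `K_a` acts
(`IsPathWeight.rotate`, `IsPathWeight.rotate_symm`); a full turn of the phases is one time step.

In a decomposed configuration the maximum can be read off. The carrier load at `s` is the net flux
of balls across `s` in one step: the longest soliton attains its length, and no ball moves further
than that.

For existence, consider non-increasing blocks at the right end of the configuration, over all times,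
and take one of maximal length. Maximality keeps its length constant, so it is a soliton; the
remaining balls evolve as if it were absent, and induction on the number of balls applies. -/

namespace BBS

variable {κ : ℕ}

/-! ### The local rule for moving one color -/

/-- The number of balls waiting at site `s` when the balls at the sites in `A` are picked up from
left to right and one waiting ball is put down at every empty site of `X`. -/
def queue (A : Finset ℕ) (X : BBSConfig κ) : ℕ → ℕ
  | 0 => 0
  | s + 1 => if s ∈ A then queue A X s + 1 else if X s = 0 then queue A X s - 1 else queue A X s

theorem queue_insert_of_le {A : Finset ℕ} (X : BBSConfig κ) {x s : ℕ} (hs : s ≤ x) :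
    queue (insert x A) X s = queue A X s := by
  induction s with
  | zero => rfl
  | succ s ih =>
    have h : s ≠ x := by omega
    simp [queue, ih (by omega), h]

theorem queue_eventually_zero (A : Finset ℕ) (X : BBSConfig κ) (p : ℕ) :
    ∃ n, queue A X (p + n) = 0 := by
  obtain ⟨B, hB⟩ : ∃ B, ∀ x, B ≤ x → x ∉ A ∪ X.support := by
    refine ⟨(A ∪ X.support).sup id + 1, fun x hx hx' => ?_⟩
    have := Finset.le_sup (f := id) hx'
    simp only [id] at this
    omega
  have key : ∀ m, queue A X (p + B + m) = queue A X (p + B) - m := by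
    intro m
    induction m with
    | zero => rfl
    | succ m ih =>
      have h := hB (p + B + m) (by omega)
      simp only [Finset.mem_union, Finsupp.mem_support_iff, not_or, not_not] at h
      rw [← Nat.add_assoc, queue, if_neg h.1, if_pos h.2, ih]
      omega
  refine ⟨B + queue A X (p + B), ?_⟩
  rw [← Nat.add_assoc, key, Nat.sub_self]

/-- The color of site `s` after the balls of color `a` at the sites in `A` have been moved. -/
def movedColor (a : Fin (κ + 1)) (A : Finset ℕ) (X : BBSConfig κ) (s : ℕ) : Fin (κ + 1) :=
  if s ∈ A then 0 else if X s = 0 ∧ 0 < queue A X s then a else X s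

/-- Picking up the ball at `x` raises the queue by one exactly on the sites after `x` up to its
landing site `y`. Originally empty sites strictly in between already receive a ball, and at `y`
nobody else is waiting. -/
theorem moveBall_eq_movedColor {a : Fin (κ + 1)} (ha : a ≠ 0) {A : Finset ℕ}
    {X Z : BBSConfig κ} {x : ℕ} (hA : ∀ y ∈ A, y < x) (hx : X x = a)
    (hZ : ∀ s, Z s = movedColor a A X s) (s : ℕ) :
    moveBall Z x s = movedColor a (insert x A) X s := by
  have hxA : x ∉ A := fun h => lt_irrefl _ (hA x h)
  have hZx : Z x = a := by simp [hZ, movedColor, hxA, hx, ha]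
  set y := sInf {y : ℕ | x < y ∧ Z y = 0} with hy
  have hne : {y : ℕ | x < y ∧ Z y = 0}.Nonempty := by
    refine ⟨x + Z.support.sup id + 1, by omega, ?_⟩
    by_contra h
    have := Finset.le_sup (f := id) (Finsupp.mem_support_iff.2 h)
    simp only [id] at this
    omega
  obtain ⟨hxy, hZy⟩ : x < y ∧ Z y = 0 := Nat.sInf_mem hne
  have hmin : ∀ z, x < z → z < y → Z z ≠ 0 := fun z h1 h2 h3 => Nat.notMem_of_lt_sInf h2 ⟨h1, h3⟩
  have hnotA : ∀ z, x < z → z ∉ A := fun z h h' => by have := hA z h'; omega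
  have hempty : ∀ z, x < z → Z z = 0 → X z = 0 ∧ queue A X z = 0 := by
    intro z hz h
    rw [hZ, movedColor, if_neg (hnotA z hz)] at h
    split_ifs at h with h1
    · exact absurd h ha
    · exact ⟨h, by by_contra h2; exact h1 ⟨h, by omega⟩⟩
  have hbusy : ∀ z, x < z → z < y → X z = 0 → 0 < queue A X z := by
    intro z hz hzy h
    by_contra h2
    refine hmin z hz hzy ?_
    rw [hZ, movedColor, if_neg (hnotA z hz), if_neg (fun h3 => h2 h3.2), h]
  have hq1 : ∀ n, x + 1 + n ≤ y →
      queue (insert x A) X (x + 1 + n) = queue A X (x + 1 + n) + 1 := by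
    intro n
    induction n with
    | zero =>
      intro _
      simp [queue, hxA, hx, ha, queue_insert_of_le X le_rfl]
    | succ n ih =>
      intro hn
      have hi := ih (by omega)
      have h1 : x + 1 + n ≠ x := by omega
      have h2 := hnotA (x + 1 + n) (by omega)
      have h3 := hbusy (x + 1 + n) (by omega) (by omega)
      rw [← Nat.add_assoc, queue, queue, if_neg h2, if_neg (by simp [h1, h2]), hi]
      split_ifs with h4
      · have := h3 h4
        omega
      · rfl
  have hq2 : ∀ n, queue (insert x A) X (y + 1 + n) = queue A X (y + 1 + n) := by
    intro n
    induction n with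
    | zero =>
      have h := hq1 (y - (x + 1)) (by omega)
      rw [show x + 1 + (y - (x + 1)) = y by omega] at h
      obtain ⟨h1, h2⟩ := hempty y hxy hZy
      have h3 := hnotA y hxy
      rw [Nat.add_zero, queue, queue, if_neg h3, if_neg (by simp [h3]; omega), h, h2]
      simp [h1]
    | succ n ih =>
      have h1 : y + 1 + n ≠ x := by omega
      rw [← Nat.add_assoc, queue, queue, ih]
      simp [h1]
  have hval : moveBall Z x s = if s = y then a else if s = x then 0 else Z s := by
    simp only [moveBall, ← hy, hZx, Finsupp.coe_update, Function.update_apply,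
      Finsupp.erase_apply]
  rw [hval]
  rcases lt_trichotomy s x with h | h | h
  · have h1 : s ≠ y := by omega
    simp [h1, h.ne, hZ, movedColor, queue_insert_of_le X h.le]
  · subst h
    simp [hxy.ne, movedColor]
  · have h1 : s ≠ x := by omega
    have h2 := hnotA s h
    rcases lt_trichotomy s y with h3 | h3 | h3
    · have h4 := hq1 (s - (x + 1)) (by omega)
      rw [show x + 1 + (s - (x + 1)) = s by omega] at h4
      have h5 := hbusy s h h3
      simp only [h3.ne, h1, hZ, movedColor, Finset.mem_insert, h2, h4, if_false, or_self]
      by_cases h6 : X s = 0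
      · simp [h6, h5 h6]
      · simp [h6]
    · have h4 := hq1 (s - (x + 1)) (by omega)
      rw [show x + 1 + (s - (x + 1)) = s by omega] at h4
      have h5 := (hempty y hxy hZy).1
      simp [h3 ▸ h4, h3, movedColor, h5, hnotA y hxy, hxy.ne']
    · have h4 := hq2 (s - (y + 1))
      rw [show y + 1 + (s - (y + 1)) = s by omega] at h4
      simp [h3.ne', h1, hZ, movedColor, h2, h4]

theorem foldl_moveBall_eq_movedColor {a : Fin (κ + 1)} (ha : a ≠ 0) (X : BBSConfig κ)
    (l : List ℕ) : ∀ (A : Finset ℕ) (Z : BBSConfig κ), l.Pairwise (· < ·) →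
      (∀ y ∈ A, ∀ x ∈ l, y < x) → (∀ x ∈ l, X x = a) → (∀ s, Z s = movedColor a A X s) →
      ∀ s, l.foldl moveBall Z s = movedColor a (A ∪ l.toFinset) X s := by
  induction l with
  | nil => intro A Z _ _ _ hZ s; simpa using hZ s
  | cons x l ih =>
    intro A Z hl hA hX hZ s
    rw [List.pairwise_cons] at hl
    have h := ih (insert x A) (moveBall Z x) hl.2 ?_ (fun z hz => hX z (by simp [hz]))
      (moveBall_eq_movedColor ha (fun y hy => hA y hy x (by simp)) (hX x (by simp)) hZ) s
    · rw [List.foldl_cons, h, List.toFinset_cons, Finset.insert_union, Finset.union_insert]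
    · intro y hy z hz
      rcases Finset.mem_insert.1 hy with rfl | hy
      · exact hl.1 z hz
      · exact hA y hy z (by simp [hz])

/-- The number of balls of color `a` that `K_a` carries across the left end of site `s`. -/
def load (a : Fin (κ + 1)) (X : BBSConfig κ) : ℕ → ℕ :=
  queue (X.support.filter fun x => X x = a) X

theorem load_zero (a : Fin (κ + 1)) (X : BBSConfig κ) : load a X 0 = 0 := rfl

theorem load_succ {a : Fin (κ + 1)} (ha : a ≠ 0) (X : BBSConfig κ) (s : ℕ) :
    load a X (s + 1) =
      if X s = a then load a X s + 1 else if X s = 0 then load a X s - 1 else load a X s := by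
  have h : (s ∈ X.support.filter fun x => X x = a) ↔ X s = a := by
    simp only [Finset.mem_filter, Finsupp.mem_support_iff, and_iff_right_iff_imp]
    rintro rfl
    exact ha
  simp only [load, queue, h]

theorem moveColor_apply {a : Fin (κ + 1)} (ha : a ≠ 0) (X : BBSConfig κ) (s : ℕ) :
    moveColor a X s =
      if X s = a then 0 else if X s = 0 ∧ 0 < load a X s then a else X s := by
  have h : (s ∈ X.support.filter fun x => X x = a) ↔ X s = a := by
    simp only [Finset.mem_filter, Finsupp.mem_support_iff, and_iff_right_iff_imp]
    rintro rfl
    exact ha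
  have hq : ∀ s, queue ∅ X s = 0 := by
    intro s
    induction s with
    | zero => rfl
    | succ s ih => simp [queue, ih]
  have := foldl_moveBall_eq_movedColor ha X (sitesOfColor a X) ∅ X
    (Finset.sortedLT_sort _).pairwise (by simp) (by simp [sitesOfColor])
    (by simp [movedColor, hq]) s
  rw [moveColor, this]
  simp only [sitesOfColor, Finset.empty_union, Finset.sort_toFinset, movedColor, h, load]
  congr

/-! ### Counting the entries of a carrier -/

namespace Carrier

/-- The number of entries of the carrier that are at least `a` (for `a ≥ 1`). -/
noncomputable def count (x : Carrier κ) (a : ℕ) : ℕ := sInf {i : ℕ | (x.entry i : ℕ) < a}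

theorem lt_count_iff (x : Carrier κ) {a : ℕ} (ha : 0 < a) (i : ℕ) :
    i < x.count a ↔ a ≤ (x.entry i : ℕ) := by
  constructor
  · intro hi
    simpa using Nat.notMem_of_lt_sInf hi
  · intro hi
    by_contra h
    have hne : {i : ℕ | (x.entry i : ℕ) < a}.Nonempty := by
      obtain ⟨j, hj⟩ := x.finite_support.exists_notMem
      refine ⟨j, ?_⟩
      have h0 : x.entry j = 0 := by simpa using hj
      simpa [h0] using ha
    have h1 : (x.entry (x.count a) : ℕ) < a := Nat.sInf_mem hne
    have h2 : (x.entry i : ℕ) ≤ x.entry (x.count a) := x.antitone (not_lt.1 h)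
    omega

theorem count_antitone (x : Carrier κ) {a b : ℕ} (ha : 0 < a) (hab : a ≤ b) :
    x.count b ≤ x.count a := by
  refine le_of_forall_lt fun i hi => ?_
  rw [lt_count_iff x (by omega)] at hi
  rw [lt_count_iff x ha]
  omega

theorem count_of_lt (x : Carrier κ) {a : ℕ} (ha : κ < a) : x.count a = 0 := by
  by_contra h
  have := (x.lt_count_iff (by omega) 0).1 (Nat.pos_of_ne_zero h)
  omega

theorem entrySite_eq_count (x : Carrier κ) (y : Fin (κ + 1)) : x.entrySite y = x.count y := rfl

theorem numNonzero_eq_count (x : Carrier κ) : x.numNonzero = x.count 1 := by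
  have : {i : ℕ | x.entry i ≠ 0} = Finset.range (x.count 1) := by
    ext i
    simp only [Set.mem_ofPred_eq, Finset.coe_range, Set.mem_Iio, x.lt_count_iff one_pos,
      Nat.one_le_iff_ne_zero, ne_eq, Fin.val_eq_zero_iff]
  rw [numNonzero, this, Set.ncard_coe_finset, Finset.card_range]

theorem count_empty (a : ℕ) : (Carrier.empty κ).count a = 0 := by
  rcases Nat.eq_zero_or_pos a with rfl | ha
  · simp [count]
  · by_contra h
    have := ((Carrier.empty κ).lt_count_iff ha 0).1 (Nat.pos_of_ne_zero h)
    simp [Carrier.empty] at this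
    omega

theorem count_shift (x : Carrier κ) {a : ℕ} (ha : 0 < a) : x.shift.count a = x.count a - 1 := by
  refine eq_of_forall_lt_iff fun i => ?_
  rw [lt_count_iff _ ha]
  have := x.lt_count_iff ha (i + 1)
  simp only [shift]
  omega

theorem count_insert (x : Carrier κ) {y : Fin (κ + 1)} (hy : y ≠ 0) {a : ℕ} (ha : 0 < a) :
    (x.insert y hy).count a =
      if a ≤ (y : ℕ) then max (x.count a) (x.count y + 1) else x.count a := by
  have hy' : 0 < (y : ℕ) := Nat.pos_of_ne_zero fun h => hy (Fin.ext h)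
  refine eq_of_forall_lt_iff fun i => ?_
  rw [lt_count_iff _ ha]
  simp only [insert, entrySite_eq_count, Function.update_apply]
  have h1 := x.lt_count_iff ha i
  have h2 := x.lt_count_iff hy' i
  by_cases hi : i = x.count y
  · rw [if_pos hi]
    split_ifs <;> omega
  · rw [if_neg hi]
    split_ifs with h
    · rw [lt_max_iff]
      omega
    · omega

end Carrier

/-! ### The carrier performs a time step -/

/-- The color dropped by the carrier at site `s`. -/
noncomputable def dropped (X : BBSConfig κ) (s : ℕ) : Fin (κ + 1) :=
  (circularExclusion (carrierProcess X s) (X s)).1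

theorem count_carrierProcess_succ_of_eq_zero {X : BBSConfig κ} {s : ℕ} (h : X s = 0) {a : ℕ}
    (ha : 0 < a) :
    (carrierProcess X (s + 1)).count a = (carrierProcess X s).count a - 1 := by
  simp only [carrierProcess, circularExclusion, dif_pos h, Carrier.count_shift _ ha]

theorem count_carrierProcess_succ_of_ne_zero {X : BBSConfig κ} {s : ℕ} (h : X s ≠ 0) {a : ℕ}
    (ha : 0 < a) :
    (carrierProcess X (s + 1)).count a =
      if a ≤ (X s : ℕ) then
        max ((carrierProcess X s).count a) ((carrierProcess X s).count (X s) + 1)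
      else (carrierProcess X s).count a := by
  simp only [carrierProcess, circularExclusion, dif_neg h, Carrier.count_insert _ h ha]

theorem le_dropped_iff_of_eq_zero {X : BBSConfig κ} {s : ℕ} (h : X s = 0) {a : ℕ} (ha : 0 < a) :
    a ≤ (dropped X s : ℕ) ↔ 0 < (carrierProcess X s).count a := by
  simp only [dropped, circularExclusion, dif_pos h, Carrier.lt_count_iff _ ha]

theorem le_dropped_iff_of_ne_zero {X : BBSConfig κ} {s : ℕ} (h : X s ≠ 0) {a : ℕ} (ha : 0 < a) :
    a ≤ (dropped X s : ℕ) ↔ (carrierProcess X s).count (X s) < (carrierProcess X s).count a := by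
  simp only [dropped, circularExclusion, dif_neg h, Carrier.lt_count_iff _ ha,
    Carrier.entrySite_eq_count]

/-- The color that is moved after `m` colors have been moved in a time step. -/
def stageColor (κ m : ℕ) : Fin (κ + 1) := Fin.ofNat (κ + 1) (κ - m)

theorem val_stageColor (κ m : ℕ) : (stageColor κ m : ℕ) = κ - m :=
  Nat.mod_eq_of_lt (by omega)

theorem stageColor_ne_zero {m : ℕ} (hm : m < κ) : stageColor κ m ≠ 0 := by
  intro h
  have := congrArg Fin.val h
  rw [val_stageColor] at this
  simp at this
  omega

/-- The configuration after the operators `K_a` with `a` in the list `w` have acted in turn. -/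
noncomputable def moveColors (w : List (Fin (κ + 1))) (X : BBSConfig κ) : BBSConfig κ :=
  w.foldl (fun Y a => moveColor a Y) X

/-- The colors `κ, κ - 1, …` of the first `m` operators of a time step. -/
def stageColors (κ m : ℕ) : List (Fin (κ + 1)) := (List.range m).map (stageColor κ)

theorem moveColors_cons (a : Fin (κ + 1)) (w : List (Fin (κ + 1))) (X : BBSConfig κ) :
    moveColors (a :: w) X = moveColors w (moveColor a X) := rfl

theorem moveColors_append (w u : List (Fin (κ + 1))) (X : BBSConfig κ) :
    moveColors (w ++ u) X = moveColors u (moveColors w X) := List.foldl_append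

theorem stageColors_succ (m : ℕ) : stageColors κ (m + 1) = stageColors κ m ++ [stageColor κ m] := by
  simp [stageColors, List.range_succ]

theorem moveColors_stageColors_succ (m : ℕ) (X : BBSConfig κ) :
    moveColors (stageColors κ (m + 1)) X =
      moveColor (stageColor κ m) (moveColors (stageColors κ m) X) := by
  rw [stageColors_succ, moveColors_append]
  rfl

theorem step_eq_moveColors (X : BBSConfig κ) : step X = moveColors (stageColors κ κ) X := by
  have h : stageColors κ κ = (List.finRange κ).reverse.map Fin.succ := by
    refine List.ext_getElem (by simp [stageColors]) fun i h1 h2 => ?_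
    simp only [stageColors, List.length_map, List.length_range] at h1
    apply Fin.ext
    simp [stageColors, val_stageColor, List.getElem_reverse]
    omega
  rw [h, moveColors, List.foldl_map, step, List.foldr_eq_foldl_reverse]

/-- After `m` operators, exactly the colors above `κ - m` have been treated: a ball of such a color
has left, and the site holds the carrier's dropped color if that color has been treated too. The
hypothesis supplies the queue loads at this one site. -/
theorem site_stage {X : BBSConfig κ} {s : ℕ}
    (hload : ∀ m < κ, load (stageColor κ m) (moveColors (stageColors κ m) X) s +
      (carrierProcess X s).count (κ - m + 1) = (carrierProcess X s).count (κ - m)) :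
    ∀ m ≤ κ, (moveColors (stageColors κ m) X s : ℕ) =
      if (X s : ℕ) = 0 ∨ κ - m < (X s : ℕ) then
        if κ - m < (dropped X s : ℕ) then (dropped X s : ℕ) else 0
      else (X s : ℕ) := by
  intro m
  induction m with
  | zero =>
    intro _
    have h1 : ¬ κ < (dropped X s : ℕ) := by omega
    have h2 : ¬ κ < (X s : ℕ) := by omega
    simp only [stageColors, moveColors, List.range_zero, List.map_nil, List.foldl_nil, Nat.sub_zero,
      if_neg h1, h2, or_false]
    split_ifs with h
    · exact h
    · rfl
  | succ m ih =>
    intro hm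
    have hi := ih (by omega)
    have hl := hload m (by omega)
    rw [moveColors_stageColors_succ, moveColor_apply (stageColor_ne_zero (by omega))]
    set Y := moveColors (stageColors κ m) X with hY
    have hc := val_stageColor κ m
    have e1 : Y s = stageColor κ m ↔ (Y s : ℕ) = κ - m := by rw [Fin.ext_iff, hc]
    have e2 : Y s = 0 ↔ (Y s : ℕ) = 0 := by rw [Fin.ext_iff]; rfl
    simp only [e1, e2]
    obtain ⟨j, hj⟩ : ∃ j, κ - m = j + 1 := ⟨κ - m - 1, by omega⟩
    rw [hj] at hi hl hc ⊢
    rw [show κ - (m + 1) = j by omega]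
    by_cases hX : X s = 0
    · have d1 := le_dropped_iff_of_eq_zero hX (a := j + 1) (by omega)
      have d2 := le_dropped_iff_of_eq_zero hX (a := j + 1 + 1) (by omega)
      have hX' : (X s : ℕ) = 0 := by rw [hX]; rfl
      rw [if_pos (Or.inl hX')] at hi ⊢
      split_ifs at hi ⊢ <;> (try simp only [Fin.val_zero, hc]) <;> omega
    · have d1 := le_dropped_iff_of_ne_zero hX (a := j + 1) (by omega)
      have d2 := le_dropped_iff_of_ne_zero hX (a := j + 1 + 1) (by omega)
      -- The right-hand side is irreflexive, so the dropped color is smaller than `X s`.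
      have d3 := le_dropped_iff_of_ne_zero hX (a := X s)
        (Nat.pos_of_ne_zero fun h => hX (Fin.ext h))
      have hX' : ¬ (X s : ℕ) = 0 := fun h => hX (Fin.ext h)
      have d4 : j + 1 + 1 ≤ (X s : ℕ) → _ :=
        fun h => (carrierProcess X s).count_antitone (a := j + 1 + 1) (by omega) h
      simp only [hX', false_or] at hi ⊢
      split_ifs at hi ⊢ <;> (try simp only [Fin.val_zero, hc]) <;> omega

/-- The load of each queue is the multiplicity of its color in the carrier, written as a difference
of two counts. In the induction on `s`, the loads at `s` determine every intermediate color of site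
`s` through `site_stage`, hence the loads at `s + 1`. -/
theorem load_stage (X : BBSConfig κ) (s : ℕ) :
    ∀ m < κ, load (stageColor κ m) (moveColors (stageColors κ m) X) s +
      (carrierProcess X s).count (κ - m + 1) = (carrierProcess X s).count (κ - m) := by
  induction s with
  | zero => intro m _; simp [load_zero, carrierProcess, Carrier.count_empty]
  | succ s ih =>
    intro m hm
    have hi := site_stage ih m hm.le
    have hl := ih m hm
    rw [load_succ (stageColor_ne_zero hm)]
    set Y := moveColors (stageColors κ m) X with hY
    have hc := val_stageColor κ m
    have e1 : Y s = stageColor κ m ↔ (Y s : ℕ) = κ - m := by rw [Fin.ext_iff, hc]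
    have e2 : Y s = 0 ↔ (Y s : ℕ) = 0 := by rw [Fin.ext_iff]; rfl
    simp only [e1, e2]
    obtain ⟨j, hj⟩ : ∃ j, κ - m = j + 1 := ⟨κ - m - 1, by omega⟩
    rw [hj] at hi hl hc ⊢
    by_cases hX : X s = 0
    · have d1 := le_dropped_iff_of_eq_zero hX (a := j + 1) (by omega)
      have d2 := le_dropped_iff_of_eq_zero hX (a := j + 1 + 1) (by omega)
      have hX' : (X s : ℕ) = 0 := by rw [hX]; rfl
      rw [if_pos (Or.inl hX')] at hi
      rw [count_carrierProcess_succ_of_eq_zero hX (by omega),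
        count_carrierProcess_succ_of_eq_zero hX (by omega)]
      split_ifs at hi ⊢ <;> omega
    · have d1 := le_dropped_iff_of_ne_zero hX (a := j + 1) (by omega)
      have d2 := le_dropped_iff_of_ne_zero hX (a := j + 1 + 1) (by omega)
      have hX' : ¬ (X s : ℕ) = 0 := fun h => hX (Fin.ext h)
      have d3 := le_dropped_iff_of_ne_zero hX (a := X s) (by omega)
      have d4 : j + 1 + 1 ≤ (X s : ℕ) → _ :=
        fun h => (carrierProcess X s).count_antitone (a := j + 1 + 1) (by omega) h
      simp only [hX', false_or] at hi
      rw [count_carrierProcess_succ_of_ne_zero hX (by omega),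
        count_carrierProcess_succ_of_ne_zero hX (by omega)]
      rcases lt_trichotomy (j + 1) (X s : ℕ) with h | h | h
      · have h1 : j + 1 + 1 ≤ (X s : ℕ) := h
        have h2 : j + 1 ≤ (X s : ℕ) := by omega
        rw [if_pos h1, if_pos h2]
        rw [if_pos h] at hi
        split_ifs at hi ⊢ <;> omega
      · rw [← h] at hi d1 d2 ⊢
        have h1 : ¬ j + 1 + 1 ≤ j + 1 := by omega
        rw [if_neg h1, if_pos le_rfl]
        rw [if_neg (lt_irrefl _)] at hi
        rw [if_pos hi]
        omega
      · have h1 : ¬ j + 1 + 1 ≤ (X s : ℕ) := by omega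
        have h2 : ¬ j + 1 ≤ (X s : ℕ) := by omega
        rw [if_neg h1, if_neg h2]
        rw [if_neg (by omega)] at hi
        split_ifs <;> omega

theorem step_apply (X : BBSConfig κ) (s : ℕ) : step X s = dropped X s := by
  have h := site_stage (load_stage X s) κ le_rfl
  rw [step_eq_moveColors]
  apply Fin.ext
  rw [h, Nat.sub_self]
  split_ifs <;> omega

/-- The total number of balls that the operators `K_a` with `a` in the list `w`, acting in turn,
carry across the left end of site `s`. -/
noncomputable def totalLoad : List (Fin (κ + 1)) → BBSConfig κ → ℕ → ℕ
  | [], _, _ => 0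
  | a :: w, X, s => load a X s + totalLoad w (moveColor a X) s

theorem totalLoad_append (w u : List (Fin (κ + 1))) (X : BBSConfig κ) (s : ℕ) :
    totalLoad (w ++ u) X s = totalLoad w X s + totalLoad u (moveColors w X) s := by
  induction w generalizing X with
  | nil => simp [totalLoad, moveColors]
  | cons a w ih =>
    rw [List.cons_append, totalLoad, ih, totalLoad, Nat.add_assoc]
    rfl

/-- The multiplicities from `load_stage` telescope, starting from the count above color `κ`, which
is zero. -/
theorem numNonzero_eq_totalLoad (X : BBSConfig κ) (s : ℕ) :
    (carrierProcess X s).numNonzero = totalLoad (stageColors κ κ) X s := by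
  have key : ∀ m ≤ κ, totalLoad (stageColors κ m) X s = (carrierProcess X s).count (κ - m + 1) := by
    intro m
    induction m with
    | zero => intro _; simp [stageColors, totalLoad, Carrier.count_of_lt]
    | succ m ih =>
      intro hm
      have := load_stage X s m (by omega)
      rw [stageColors_succ, totalLoad_append, ih (by omega),
        show κ - (m + 1) + 1 = κ - m by omega, ← this]
      simp [totalLoad, Nat.add_comm]
  rw [Carrier.numNonzero_eq_count, key κ le_rfl, Nat.sub_self]

/-! ### Paths and the conservation of the maximal load -/

/-- The number of sites of color `a` to the left of site `s`. -/
def numBefore (X : BBSConfig κ) (a : Fin (κ + 1)) (s : ℕ) : ℕ := Nat.count (fun x => X x = a) s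

theorem numBefore_succ (X : BBSConfig κ) (a : Fin (κ + 1)) (s : ℕ) :
    numBefore X a (s + 1) = numBefore X a s + if X s = a then 1 else 0 :=
  Nat.count_succ _ _

theorem numBefore_moveColor_of_ne {a b : Fin (κ + 1)} (ha : a ≠ 0) (hab : b ≠ a) (hb : b ≠ 0)
    (X : BBSConfig κ) (s : ℕ) : numBefore (moveColor a X) b s = numBefore X b s := by
  induction s with
  | zero => rfl
  | succ s ih =>
    have h : moveColor a X s = b ↔ X s = b := by
      rw [moveColor_apply ha]
      split_ifs with h1 h2
      · simp [h1, hab.symm, hb.symm]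
      · simp [h2.1, hab.symm, hb.symm]
      · rfl
    simp only [numBefore_succ, ih, h]

theorem numBefore_zero_moveColor {a : Fin (κ + 1)} (ha : a ≠ 0) (X : BBSConfig κ) (s : ℕ) :
    numBefore (moveColor a X) 0 s = numBefore X 0 s + load a X s := by
  induction s with
  | zero => simp [numBefore, load_zero]
  | succ s ih =>
    simp only [numBefore_succ, load_succ ha, moveColor_apply ha]
    by_cases h1 : X s = a
    · simp [h1, ha]
      omega
    · by_cases h2 : X s = 0
      · by_cases h3 : 0 < load a X s
        · simp [h2, h3, ha, ha.symm]
          omega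
        · simp [h2, h3, ha.symm]
          omega
      · simp [h1, h2]
        omega

/-- Each arrival adds one to the queue and an empty site removes at most one. With `exists_load_eq`,
this makes the load at `q` the maximum over `p ≤ q` of arrivals minus empty sites between `p` and
`q`. -/
theorem load_lower_bound {a : Fin (κ + 1)} (ha : a ≠ 0) (X : BBSConfig κ) {p q : ℕ} (hpq : p ≤ q) :
    numBefore X a q + numBefore X 0 p ≤ load a X q + numBefore X a p + numBefore X 0 q := by
  induction q, hpq using Nat.le_induction with
  | base => omega
  | succ q _ ih =>
    simp only [numBefore_succ, load_succ ha]
    by_cases h1 : X q = a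
    · simp [h1, ha]
      omega
    · by_cases h2 : X q = 0
      · simp [h2, ha.symm]
        omega
      · simp [h1, h2]
        omega

theorem exists_load_eq {a : Fin (κ + 1)} (ha : a ≠ 0) (X : BBSConfig κ) (q : ℕ) :
    ∃ p ≤ q, numBefore X a q + numBefore X 0 p =
      load a X q + numBefore X a p + numBefore X 0 q := by
  induction q with
  | zero => exact ⟨0, le_rfl, by simp [load_zero]⟩
  | succ q ih =>
    by_cases h0 : load a X (q + 1) = 0
    · exact ⟨q + 1, le_rfl, by omega⟩
    obtain ⟨p, hp, h⟩ := ih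
    refine ⟨p, by omega, ?_⟩
    revert h0
    simp only [numBefore_succ, load_succ ha]
    by_cases h1 : X q = a
    · simp [h1, ha]
      omega
    · by_cases h2 : X q = 0
      · simp [h2, ha.symm]
        omega
      · simp [h1, h2]
        omega

/-- The mirror image of `load_lower_bound`: read from right to left, the output is again a queue
with the same loads. The load at `p` is thus a maximum over intervals of the output that start at
`p`, attained by `exists_load_eq_after`. -/
theorem load_upper_bound {a : Fin (κ + 1)} (ha : a ≠ 0) (X : BBSConfig κ) {p q : ℕ}
    (hpq : p ≤ q) :
    numBefore (moveColor a X) a q + numBefore (moveColor a X) 0 p ≤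
      load a X p + numBefore (moveColor a X) a p + numBefore (moveColor a X) 0 q := by
  -- Keeping the balls still waiting at `q` in the balance makes the induction go through.
  suffices h : load a X q + numBefore (moveColor a X) a q + numBefore (moveColor a X) 0 p ≤
      load a X p + numBefore (moveColor a X) a p + numBefore (moveColor a X) 0 q by omega
  induction q, hpq using Nat.le_induction with
  | base => omega
  | succ q _ ih =>
    simp only [numBefore_succ, load_succ ha, moveColor_apply ha]
    by_cases h1 : X q = a
    · simp [h1, ha.symm]
      omega
    · by_cases h2 : X q = 0
      · by_cases h3 : 0 < load a X q
        · simp [h2, h3, ha, ha.symm]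
          omega
        · simp [h2, h3, ha.symm]
          omega
      · simp [h1, h2]
        omega

/-- The witness is the first site from `p` on with zero load. Before it every empty site of `X` is
filled, so the empty sites of the output are the former sites of color `a`. -/
theorem exists_load_eq_after {a : Fin (κ + 1)} (ha : a ≠ 0) (X : BBSConfig κ) (p : ℕ) :
    ∃ q ≥ p, numBefore (moveColor a X) a q + numBefore (moveColor a X) 0 p =
      load a X p + numBefore (moveColor a X) a p + numBefore (moveColor a X) 0 q := by
  obtain ⟨n, hn⟩ : ∃ n, load a X (p + n) = 0 := queue_eventually_zero _ X p
  induction n generalizing p with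
  | zero =>
    rw [Nat.add_zero] at hn
    exact ⟨p, le_rfl, by omega⟩
  | succ n ih =>
    by_cases h0 : load a X p = 0
    · exact ⟨p, le_rfl, by omega⟩
    obtain ⟨q, hq, h⟩ := ih (p + 1) (by rwa [Nat.add_assoc, Nat.add_comm 1 n])
    refine ⟨q, by omega, ?_⟩
    revert h
    simp only [numBefore_succ _ _ p, load_succ ha, moveColor_apply ha]
    by_cases h1 : X p = a
    · simp [h1, ha.symm]
      omega
    · by_cases h2 : X p = 0
      · simp [h2, Nat.pos_of_ne_zero h0, ha, ha.symm]
        omega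
      · simp [h1, h2]

/-- `IsPathLength X w p r v`: the interval of sites from `p` to `r` can be cut into consecutive
intervals, one for each color in the list `w`, such that `v` is the sum of the numbers of balls
that have the color of the interval that contains them. -/
def IsPathLength (X : BBSConfig κ) : List (Fin (κ + 1)) → ℕ → ℕ → ℤ → Prop
  | [], p, r, v => p = r ∧ v = 0
  | a :: w, p, r, v => ∃ q u, p ≤ q ∧ IsPathLength X w q r u ∧
      v = numBefore X a q - numBefore X a p + u

theorem IsPathLength.le {X : BBSConfig κ} {w : List (Fin (κ + 1))} {p r : ℕ} {v : ℤ}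
    (h : IsPathLength X w p r v) : p ≤ r := by
  induction w generalizing p v with
  | nil => exact h.1.le
  | cons a w ih =>
    obtain ⟨q, u, hq, hu, -⟩ := h
    exact hq.trans (ih hu)

theorem isPathLength_concat {X : BBSConfig κ} {w : List (Fin (κ + 1))} {a : Fin (κ + 1)} {p r : ℕ}
    {v : ℤ} : IsPathLength X (w ++ [a]) p r v ↔
      ∃ q u, q ≤ r ∧ IsPathLength X w p q u ∧ v = u + (numBefore X a r - numBefore X a q) := by
  induction w generalizing p v with
  | nil =>
    constructor
    · rintro ⟨q, u, hq, ⟨rfl, rfl⟩, rfl⟩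
      exact ⟨p, 0, hq, ⟨rfl, rfl⟩, by omega⟩
    · rintro ⟨q, u, hq, ⟨rfl, rfl⟩, rfl⟩
      exact ⟨r, 0, hq, ⟨rfl, rfl⟩, by omega⟩
  | cons b w ih =>
    constructor
    · rintro ⟨q, u, hq, hu, rfl⟩
      obtain ⟨q', u', hq', hu', rfl⟩ := ih.1 hu
      exact ⟨q', _, hq', ⟨q, u', hq, hu', rfl⟩, by omega⟩
    · rintro ⟨q', u, hq', ⟨q, u', hq, hu', rfl⟩, rfl⟩
      exact ⟨q, _, hq, ih.2 ⟨q', u', hq', hu', rfl⟩, by omega⟩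

theorem isPathLength_moveColor {a : Fin (κ + 1)} (ha : a ≠ 0) {w : List (Fin (κ + 1))}
    (haw : a ∉ w) (h0w : 0 ∉ w) {X : BBSConfig κ} {p r : ℕ} {v : ℤ} :
    IsPathLength (moveColor a X) w p r v ↔ IsPathLength X w p r v := by
  induction w generalizing p v with
  | nil => rfl
  | cons b w ih =>
    simp only [List.mem_cons, not_or] at haw h0w
    simp only [IsPathLength, ih haw.2 h0w.2,
      numBefore_moveColor_of_ne ha (Ne.symm haw.1) (Ne.symm h0w.1)]

/-- The length of a path is at most the load at its end plus the number of empty sites on it. -/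
theorem IsPathLength.le_totalLoad {w : List (Fin (κ + 1))} (hw : w.Nodup) (h0 : 0 ∉ w)
    {X : BBSConfig κ} {p s : ℕ} {v : ℤ} (h : IsPathLength X w p s v) :
    v - (numBefore X 0 s - numBefore X 0 p) ≤ totalLoad w X s := by
  induction w generalizing X p v with
  | nil =>
    obtain ⟨rfl, rfl⟩ := h
    simp [totalLoad]
  | cons a w ih =>
    obtain ⟨q, u, hq, hu, rfl⟩ := h
    simp only [List.mem_cons, not_or] at h0
    have ha : a ≠ 0 := Ne.symm h0.1
    rw [List.nodup_cons] at hw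
    have h1 := ih hw.2 h0.2 ((isPathLength_moveColor ha hw.1 h0.2).2 hu)
    have h2 := load_lower_bound ha X hq
    have h3 := numBefore_zero_moveColor ha X q
    have h4 := numBefore_zero_moveColor ha X s
    simp only [totalLoad]
    push_cast
    omega

theorem exists_isPathLength_eq_totalLoad {w : List (Fin (κ + 1))} (hw : w.Nodup) (h0 : 0 ∉ w)
    (X : BBSConfig κ) (s : ℕ) :
    ∃ p v, IsPathLength X w p s v ∧
      v - (numBefore X 0 s - numBefore X 0 p) = totalLoad w X s := by
  induction w generalizing X with
  | nil => exact ⟨s, 0, ⟨rfl, rfl⟩, by simp [totalLoad]⟩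
  | cons a w ih =>
    simp only [List.mem_cons, not_or] at h0
    have ha : a ≠ 0 := Ne.symm h0.1
    rw [List.nodup_cons] at hw
    obtain ⟨q, u, hu, h1⟩ := ih hw.2 h0.2 (moveColor a X)
    obtain ⟨p, hp, h2⟩ := exists_load_eq ha X q
    have h3 := numBefore_zero_moveColor ha X q
    have h4 := numBefore_zero_moveColor ha X s
    refine ⟨p, _, ⟨q, u, hp, (isPathLength_moveColor ha hw.1 h0.2).1 hu, rfl⟩, ?_⟩
    simp only [totalLoad]
    push_cast
    omega

/-- `v` is the length of a path with phases `w` minus the number of empty sites on it. -/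
def IsPathWeight (X : BBSConfig κ) (w : List (Fin (κ + 1))) (v : ℤ) : Prop :=
  ∃ p r u, IsPathLength X w p r u ∧ v = u - (numBefore X 0 r - numBefore X 0 p)

/-- The first phase, from `p` to `q`, is worth at most the load at `q`. Deleting it and applying
`K_a` changes the weight of the rest by the load at `q` minus the load at `r`, because `K_a` alters
the count of empty sites by the load. A final phase of color `a` recovers the load at `r`. -/
theorem IsPathWeight.rotate {a : Fin (κ + 1)} {w : List (Fin (κ + 1))} (hw : (a :: w).Nodup)
    (h0 : 0 ∉ a :: w) {X : BBSConfig κ} {v : ℤ} (h : IsPathWeight X (a :: w) v) :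
    ∃ v' ≥ v, IsPathWeight (moveColor a X) (w ++ [a]) v' := by
  simp only [List.mem_cons, not_or] at h0
  have ha : a ≠ 0 := Ne.symm h0.1
  rw [List.nodup_cons] at hw
  obtain ⟨p, r, -, ⟨q, u, hq, hu, rfl⟩, rfl⟩ := h
  obtain ⟨r', hr, h1⟩ := exists_load_eq_after ha X r
  have h2 := load_lower_bound ha X hq
  have h3 := numBefore_zero_moveColor ha X q
  have h4 := numBefore_zero_moveColor ha X r
  refine ⟨_, ?_, q, r', _, isPathLength_concat.2
    ⟨r, u, hr, (isPathLength_moveColor ha hw.1 h0.2).2 hu, rfl⟩, rfl⟩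
  omega

theorem IsPathWeight.rotate_symm {a : Fin (κ + 1)} {w : List (Fin (κ + 1))} (hw : (a :: w).Nodup)
    (h0 : 0 ∉ a :: w) {X : BBSConfig κ} {v : ℤ} (h : IsPathWeight (moveColor a X) (w ++ [a]) v) :
    ∃ v' ≥ v, IsPathWeight X (a :: w) v' := by
  simp only [List.mem_cons, not_or] at h0
  have ha : a ≠ 0 := Ne.symm h0.1
  rw [List.nodup_cons] at hw
  obtain ⟨p, r, v, hv, rfl⟩ := h
  obtain ⟨q, u, hq, hu, rfl⟩ := isPathLength_concat.1 hv
  obtain ⟨p', hp, h1⟩ := exists_load_eq ha X p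
  have h2 := load_upper_bound ha X hq
  have h3 := numBefore_zero_moveColor ha X p
  have h4 := numBefore_zero_moveColor ha X q
  refine ⟨_, ?_, p', q, _,
    ⟨p, u, hp, (isPathLength_moveColor ha hw.1 h0.2).1 hu, rfl⟩, rfl⟩
  omega

theorem IsPathWeight.moveColors {w u : List (Fin (κ + 1))} (hw : (w ++ u).Nodup)
    (h0 : 0 ∉ w ++ u) {X : BBSConfig κ} {v : ℤ} (h : IsPathWeight X (w ++ u) v) :
    ∃ v' ≥ v, IsPathWeight (moveColors w X) (u ++ w) v' := by
  induction w generalizing u X v with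
  | nil => exact ⟨v, le_rfl, by simpa [BBS.moveColors] using h⟩
  | cons a w ih =>
    obtain ⟨v₁, hv₁, h₁⟩ := h.rotate hw h0
    replace h₁ : IsPathWeight (moveColor a X) (w ++ (u ++ [a])) v₁ := by
      rw [← List.append_assoc]
      exact h₁
    have hp : (w ++ (u ++ [a])).Perm (a :: w ++ u) := by
      rw [← List.append_assoc]
      exact List.perm_append_singleton a (w ++ u)
    obtain ⟨v₂, hv₂, h₂⟩ := ih (hp.nodup_iff.2 hw) (by rwa [hp.mem_iff]) h₁
    exact ⟨v₂, hv₁.trans hv₂, by simpa [moveColors_cons] using h₂⟩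

theorem IsPathWeight.moveColors_symm {w u : List (Fin (κ + 1))} (hw : (w ++ u).Nodup)
    (h0 : 0 ∉ w ++ u) {X : BBSConfig κ} {v : ℤ}
    (h : IsPathWeight (BBS.moveColors w X) (u ++ w) v) :
    ∃ v' ≥ v, IsPathWeight X (w ++ u) v' := by
  induction w generalizing u X v with
  | nil => exact ⟨v, le_rfl, by simpa [BBS.moveColors] using h⟩
  | cons a w ih =>
    have hp : (w ++ (u ++ [a])).Perm (a :: w ++ u) := by
      rw [← List.append_assoc]
      exact List.perm_append_singleton a (w ++ u)
    obtain ⟨v₁, hv₁, h₁⟩ := ih (u := u ++ [a]) (X := moveColor a X) (hp.nodup_iff.2 hw)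
      (by rwa [hp.mem_iff]) (by simpa [moveColors_cons] using h)
    rw [← List.append_assoc] at h₁
    obtain ⟨v₂, hv₂, h₂⟩ := h₁.rotate_symm hw h0
    exact ⟨v₂, hv₁.trans hv₂, h₂⟩

/-! ### A full turn of the phases is a time step -/

theorem nodup_stageColors : (stageColors κ κ).Nodup := by
  refine List.Nodup.map_on ?_ List.nodup_range
  intro i hi j hj h
  have := congrArg Fin.val h
  rw [val_stageColor, val_stageColor] at this
  rw [List.mem_range] at hi hj
  omega

theorem zero_notMem_stageColors : 0 ∉ stageColors κ κ := by
  simp only [stageColors, List.mem_map, List.mem_range, not_exists, not_and]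
  exact fun m hm => stageColor_ne_zero hm

theorem exists_isPathWeight (X : BBSConfig κ) (s : ℕ) :
    IsPathWeight X (stageColors κ κ) (carrierProcess X s).numNonzero := by
  obtain ⟨p, v, hv, h⟩ := exists_isPathLength_eq_totalLoad nodup_stageColors
    zero_notMem_stageColors X s
  exact ⟨p, s, v, hv, by rw [numNonzero_eq_totalLoad, h]⟩

theorem IsPathWeight.exists_le_numNonzero {X : BBSConfig κ} {v : ℤ}
    (h : IsPathWeight X (stageColors κ κ) v) : ∃ s, v ≤ (carrierProcess X s).numNonzero := by
  obtain ⟨p, r, u, hu, rfl⟩ := h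
  refine ⟨r, ?_⟩
  rw [numNonzero_eq_totalLoad]
  exact hu.le_totalLoad nodup_stageColors zero_notMem_stageColors

theorem exists_numNonzero_le_step (X : BBSConfig κ) (s : ℕ) :
    ∃ r, (carrierProcess X s).numNonzero ≤ (carrierProcess (step X) r).numNonzero := by
  have h := exists_isPathWeight X s
  rw [← List.append_nil (stageColors κ κ)] at h
  obtain ⟨v, hv, h'⟩ := h.moveColors (by simpa using nodup_stageColors)
    (by simpa using zero_notMem_stageColors)
  rw [List.nil_append, ← step_eq_moveColors] at h'
  obtain ⟨r, hr⟩ := h'.exists_le_numNonzero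
  exact ⟨r, by omega⟩

theorem exists_numNonzero_step_le (X : BBSConfig κ) (s : ℕ) :
    ∃ r, (carrierProcess (step X) s).numNonzero ≤ (carrierProcess X r).numNonzero := by
  have h := exists_isPathWeight (step X) s
  rw [← List.nil_append (stageColors κ κ), step_eq_moveColors] at h
  obtain ⟨v, hv, h'⟩ := h.moveColors_symm (by simpa using nodup_stageColors)
    (by simpa using zero_notMem_stageColors)
  rw [List.append_nil] at h'
  obtain ⟨r, hr⟩ := h'.exists_le_numNonzero
  exact ⟨r, by rw [step_eq_moveColors]; omega⟩

theorem isGreatest_numNonzero_step (X : BBSConfig κ) (m : ℕ) :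
    IsGreatest (Set.range fun s => (carrierProcess (step X) s).numNonzero) m ↔
      IsGreatest (Set.range fun s => (carrierProcess X s).numNonzero) m := by
  have key : ∀ Y Z : BBSConfig κ,
      (∀ s, ∃ r, (carrierProcess Y s).numNonzero ≤ (carrierProcess Z r).numNonzero) →
      (∀ s, ∃ r, (carrierProcess Z s).numNonzero ≤ (carrierProcess Y r).numNonzero) →
      IsGreatest (Set.range fun s => (carrierProcess Y s).numNonzero) m →
      IsGreatest (Set.range fun s => (carrierProcess Z s).numNonzero) m := by
    rintro Y Z h1 h2 ⟨⟨s, rfl⟩, hm⟩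
    have hZ : ∀ r, (carrierProcess Z r).numNonzero ≤ (carrierProcess Y s).numNonzero := by
      intro r
      obtain ⟨r', hr'⟩ := h2 r
      exact hr'.trans (hm ⟨r', rfl⟩)
    obtain ⟨r, hr⟩ := h1 s
    refine ⟨⟨r, le_antisymm (hZ r) hr⟩, ?_⟩
    rintro _ ⟨r, rfl⟩
    exact hZ r
  exact ⟨key _ _ (exists_numNonzero_step_le X) (exists_numNonzero_le_step X),
    key _ _ (exists_numNonzero_le_step X) (exists_numNonzero_step_le X)⟩

theorem trajectory_succ (X : BBSConfig κ) (t : ℕ) :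
    trajectory X (t + 1) = step (trajectory X t) := Function.iterate_succ_apply' _ _ _

theorem trajectory_add (X : BBSConfig κ) (s t : ℕ) :
    trajectory X (s + t) = trajectory (trajectory X s) t := by
  rw [trajectory, Nat.add_comm, Function.iterate_add_apply]
  rfl

theorem isGreatest_numNonzero_trajectory (X : BBSConfig κ) (t m : ℕ) :
    IsGreatest (Set.range fun s => (carrierProcess (trajectory X t) s).numNonzero) m ↔
      IsGreatest (Set.range fun s => (carrierProcess X s).numNonzero) m := by
  induction t with
  | zero => rfl
  | succ t ih => rw [trajectory_succ, isGreatest_numNonzero_step, ih]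

/-! ### The load as a flux of balls -/

/-- The number of balls to the left of site `s`. -/
def ballsBefore (X : BBSConfig κ) (s : ℕ) : ℕ := Nat.count (fun x => X x ≠ 0) s

theorem ballsBefore_succ (X : BBSConfig κ) (s : ℕ) :
    ballsBefore X (s + 1) = ballsBefore X s + if X s ≠ 0 then 1 else 0 :=
  Nat.count_succ _ _

theorem ballsBefore_eq_card (X : BBSConfig κ) (s : ℕ) :
    ballsBefore X s = ((Finset.range s).filter fun x => X x ≠ 0).card :=
  Nat.count_eq_card_filter_range _ _

theorem ne_zero_iff_one_le_val (a : Fin (κ + 1)) : a ≠ 0 ↔ 1 ≤ (a : ℕ) := by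
  rw [Nat.one_le_iff_ne_zero, ne_eq, ne_eq, Fin.val_eq_zero_iff]

/-- Conservation of balls: those read so far have either been dropped or are still in the carrier.
-/
theorem numNonzero_add_ballsBefore_step (X : BBSConfig κ) (s : ℕ) :
    (carrierProcess X s).numNonzero + ballsBefore (step X) s = ballsBefore X s := by
  rw [Carrier.numNonzero_eq_count]
  induction s with
  | zero => simp [carrierProcess, Carrier.count_empty, ballsBefore]
  | succ s ih =>
    rw [ballsBefore_succ, ballsBefore_succ, step_apply]
    simp only [ne_zero_iff_one_le_val (dropped X s)]
    by_cases hX : X s = 0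
    · rw [count_carrierProcess_succ_of_eq_zero hX one_pos]
      simp only [le_dropped_iff_of_eq_zero hX one_pos, hX, ne_eq, not_true, if_false]
      split_ifs <;> omega
    · have h1 := (ne_zero_iff_one_le_val _).1 hX
      have h2 := (carrierProcess X s).count_antitone one_pos h1
      rw [count_carrierProcess_succ_of_ne_zero hX one_pos, if_pos h1]
      simp only [le_dropped_iff_of_ne_zero hX one_pos, hX, ne_eq, not_false_iff, if_true]
      split_ifs <;> omega

theorem ballsBefore_le_card_support (X : BBSConfig κ) (s : ℕ) :
    ballsBefore X s ≤ X.support.card := by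
  rw [ballsBefore_eq_card]
  refine Finset.card_le_card fun x hx => ?_
  simpa using (Finset.mem_filter.1 hx).2

theorem exists_ballsBefore_eq_card_support (X : BBSConfig κ) :
    ∃ s, ballsBefore X s = X.support.card := by
  refine ⟨X.support.sup id + 1, ?_⟩
  rw [ballsBefore_eq_card]
  congr 1
  ext x
  simp only [Finset.mem_filter, Finset.mem_range, Finsupp.mem_support_iff, and_iff_right_iff_imp]
  intro hx
  have := Finset.le_sup (f := id) (Finsupp.mem_support_iff.2 hx)
  simp only [id] at this
  omega

theorem card_support_step_le (X : BBSConfig κ) : (step X).support.card ≤ X.support.card := by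
  obtain ⟨s, hs⟩ := exists_ballsBefore_eq_card_support (step X)
  have h1 := numNonzero_add_ballsBefore_step X s
  have h2 := ballsBefore_le_card_support X s
  omega

theorem card_support_trajectory_le (X : BBSConfig κ) (t : ℕ) :
    (trajectory X t).support.card ≤ X.support.card := by
  induction t with
  | zero => exact le_rfl
  | succ t ih =>
    rw [trajectory_succ]
    exact (card_support_step_le _).trans ih

theorem numNonzero_le_card_support (X : BBSConfig κ) (s : ℕ) :
    (carrierProcess X s).numNonzero ≤ X.support.card := by
  have h1 := numNonzero_add_ballsBefore_step X s
  have h2 := ballsBefore_le_card_support X s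
  omega

/-! ### The maximal load of a soliton decomposition -/

/-- Since the colors do not increase, each ball of the block enters to the right of all its
predecessors in the block, so the relevant count grows by at least one per ball. -/
theorem count_add_lt_count_of_block {X : BBSConfig κ} {a k : ℕ} (hocc : ∀ i < k, X (a + i) ≠ 0)
    (hdec : ∀ i j, i ≤ j → j < k → X (a + j) ≤ X (a + i)) :
    ∀ i < k, (carrierProcess X a).count (X a) + i <
      (carrierProcess X (a + i + 1)).count (X (a + i)) := by
  have hins : ∀ i < k, (carrierProcess X (a + i)).count (X (a + i)) <
      (carrierProcess X (a + i + 1)).count (X (a + i)) := by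
    intro i hi
    have h := (ne_zero_iff_one_le_val _).1 (hocc i hi)
    rw [count_carrierProcess_succ_of_ne_zero (hocc i hi) h, if_pos le_rfl]
    omega
  intro i
  induction i with
  | zero => exact hins 0
  | succ i ih =>
    intro hi
    have h1 := ih (by omega)
    have h2 := hins (i + 1) hi
    have h3 := (carrierProcess X (a + (i + 1))).count_antitone
      ((ne_zero_iff_one_le_val _).1 (hocc (i + 1) hi))
      (Fin.le_def.1 (hdec i (i + 1) (by omega) hi))
    simp only [← Nat.add_assoc] at h2 h3 ⊢
    omega

theorem le_numNonzero_of_block {X : BBSConfig κ} {a k : ℕ} (hk : 0 < k)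
    (hocc : ∀ i < k, X (a + i) ≠ 0)
    (hdec : ∀ i j, i ≤ j → j < k → X (a + j) ≤ X (a + i)) :
    k ≤ (carrierProcess X (a + k)).numNonzero := by
  have h1 := count_add_lt_count_of_block hocc hdec (k - 1) (by omega)
  have h2 := (carrierProcess X (a + (k - 1) + 1)).count_antitone one_pos
    ((ne_zero_iff_one_le_val _).1 (hocc (k - 1) (by omega)))
  rw [show a + (k - 1) + 1 = a + k by omega] at h1 h2
  rw [Carrier.numNonzero_eq_count]
  omega

theorem IsSolitonDecomposition.length_le_length {X : BBSConfig κ} {S : List (ℕ × ℕ)}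
    (h : IsSolitonDecomposition X S) {p q : ℕ × ℕ} (hp : p ∈ S) (hq : q ∈ S) {x y : ℕ}
    (hxy : x ≤ y) (hpx : p.1 ≤ x) (hyq : y < q.1 + q.2) : p.2 ≤ q.2 := by
  obtain ⟨i, hi, rfl⟩ := List.getElem_of_mem hp
  obtain ⟨j, hj, rfl⟩ := List.getElem_of_mem hq
  have ho := List.pairwise_iff_getElem.1 h.ordered
  rcases lt_trichotomy i j with hij | rfl | hij
  · exact (ho i j hi hj hij).2
  · exact le_rfl
  · have := (ho j i hj hi hij).1
    omega

/-- The load at `s` is a flux. Balls that stay left of `s` inject into the balls left of `s` one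
step later; the others lie on the last `m` sites before `s`. -/
theorem IsSolitonDecomposition.numNonzero_le {X : BBSConfig κ} {S : List (ℕ × ℕ)}
    (h : IsSolitonDecomposition X S) {m : ℕ} (hm : ∀ p ∈ S, p.2 ≤ m) (s : ℕ) :
    (carrierProcess X s).numNonzero ≤ m := by
  have hc : ∀ x, ∃ p : ℕ × ℕ, X x ≠ 0 → p ∈ S ∧ p.1 ≤ x ∧ x < p.1 + p.2 := by
    intro x
    by_cases hx : X x = 0
    · exact ⟨(0, 0), fun h => absurd hx h⟩
    · obtain ⟨p, hp⟩ := h.covers x hx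
      exact ⟨p, fun _ => hp⟩
  choose P hP using hc
  have hflux := numNonzero_add_ballsBefore_step X s
  rw [ballsBefore_eq_card, ballsBefore_eq_card] at hflux
  have h1 : (((Finset.range s).filter fun x => X x ≠ 0).filter fun x => x + (P x).2 < s).card ≤
      ((Finset.range s).filter fun x => step X x ≠ 0).card := by
    refine Finset.card_le_card_of_injOn (fun x => x + (P x).2) ?_ ?_
    · intro x hx
      simp only [Finset.coe_filter, Finset.mem_filter, Finset.mem_range, Set.mem_ofPred_eq] at hx ⊢
      refine ⟨hx.2, ?_⟩
      obtain ⟨hp, hpx, hxp⟩ := hP x hx.1.2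
      have := (h.isSoliton _ hp).preserved 1 (x - (P x).1) (by omega)
      rw [show (P x).1 + 1 * (P x).2 + (x - (P x).1) = x + (P x).2 by omega,
        show (P x).1 + (x - (P x).1) = x by omega] at this
      exact this ▸ hx.1.2
    -- Solitons further right are at least as long, so the shift preserves the order of the balls.
    · have hmono : ∀ x y, X x ≠ 0 → X y ≠ 0 → x < y → x + (P x).2 < y + (P y).2 := by
        intro x y hx hy hxy
        have := h.length_le_length (hP x hx).1 (hP y hy).1 hxy.le (hP x hx).2.1 (hP y hy).2.2
        omega
      intro x hx y hy hxy
      simp only [Finset.coe_filter, Finset.mem_filter, Set.mem_ofPred_eq] at hx hy hxy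
      rcases lt_trichotomy x y with hlt | heq | hlt
      · have := hmono x y hx.1.2 hy.1.2 hlt
        omega
      · exact heq
      · have := hmono y x hy.1.2 hx.1.2 hlt
        omega
  have h2 : (((Finset.range s).filter fun x => X x ≠ 0).filter
      fun x => ¬ x + (P x).2 < s).card ≤ m := by
    calc _ ≤ (Finset.Ico (s - m) s).card := by
          refine Finset.card_le_card fun x hx => ?_
          simp only [Finset.mem_filter, Finset.mem_range] at hx
          have := hm _ (hP x hx.1.2).1
          rw [Finset.mem_Ico]
          omega
      _ ≤ m := by rw [Nat.card_Ico]; omega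
  have h3 := Finset.card_filter_add_card_filter_not (s := (Finset.range s).filter fun x => X x ≠ 0)
    (fun x => x + (P x).2 < s)
  omega

theorem IsSolitonDecomposition.isGreatest {X : BBSConfig κ} {S : List (ℕ × ℕ)}
    (h : IsSolitonDecomposition X S) :
    IsGreatest (Set.range fun s => (carrierProcess X s).numNonzero)
      ((S.map Prod.snd).reverse.getD 0 0) := by
  have hle : ∀ p ∈ S, p.2 ≤ (S.map Prod.snd).reverse.getD 0 0 := by
    rcases List.eq_nil_or_concat' S with rfl | ⟨S', q, rfl⟩
    · simp
    · intro p hp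
      have ho := (List.pairwise_append.1 h.ordered).2.2
      rcases List.mem_append.1 hp with hp | hp
      · simpa using (ho p hp q (by simp)).2
      · simp_all
  have hex : ∃ s, (S.map Prod.snd).reverse.getD 0 0 ≤ (carrierProcess X s).numNonzero := by
    rcases List.eq_nil_or_concat' S with rfl | ⟨S', q, rfl⟩
    · exact ⟨0, by simp⟩
    · have hq := h.isSoliton q (by simp)
      exact ⟨q.1 + q.2, by simpa using le_numNonzero_of_block hq.pos hq.occupied hq.nonincreasing⟩
  obtain ⟨s, hs⟩ := hex
  refine ⟨⟨s, le_antisymm (h.numNonzero_le hle s) hs⟩, ?_⟩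
  rintro _ ⟨r, rfl⟩
  exact h.numNonzero_le hle r

/-! ### Terminal blocks -/

theorem carrierProcess_congr {X Y : BBSConfig κ} {s : ℕ} (h : ∀ x < s, X x = Y x) :
    carrierProcess X s = carrierProcess Y s := by
  induction s with
  | zero => rfl
  | succ s ih => rw [carrierProcess, carrierProcess, ih fun x hx => h x (by omega), h s (by omega)]

theorem step_apply_congr {X Y : BBSConfig κ} {s : ℕ} (h : ∀ x ≤ s, X x = Y x) :
    step X s = step Y s := by
  rw [step_apply, step_apply, dropped, dropped, carrierProcess_congr fun x hx => h x hx.le,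
    h s le_rfl]

theorem entry_carrierProcess_of_empty {X : BBSConfig κ} {c : ℕ} (h : ∀ x ≥ c, X x = 0)
    (i j : ℕ) : (carrierProcess X (c + i)).entry j = (carrierProcess X c).entry (i + j) := by
  induction i generalizing j with
  | zero => simp
  | succ i ih =>
    rw [← Nat.add_assoc, carrierProcess, circularExclusion, dif_pos (h _ (by omega))]
    simp only [Carrier.shift]
    rw [ih, show i + (j + 1) = i + 1 + j by omega]

theorem step_apply_of_empty {X : BBSConfig κ} {c : ℕ} (h : ∀ x ≥ c, X x = 0) (i : ℕ) :
    step X (c + i) = (carrierProcess X c).entry i := by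
  rw [step_apply, dropped, circularExclusion, dif_pos (h _ (by omega))]
  exact entry_carrierProcess_of_empty h i 0

theorem Carrier.entry_ne_zero_iff (x : Carrier κ) (i : ℕ) : x.entry i ≠ 0 ↔ i < x.numNonzero := by
  rw [x.numNonzero_eq_count, x.lt_count_iff one_pos, ne_zero_iff_one_le_val]

/-- The rightmost balls of `X` fill the block of the `v ≥ 1` sites `b, …, b + v - 1`, and their
colors are non-increasing. -/
structure IsTerminalBlock (X : BBSConfig κ) (b v : ℕ) : Prop where
  pos : 0 < v
  occupied : ∀ i < v, X (b + i) ≠ 0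
  nonincreasing : ∀ i j, i ≤ j → j < v → X (b + j) ≤ X (b + i)
  empty : ∀ x ≥ b + v, X x = 0

theorem exists_isTerminalBlock {X : BBSConfig κ} (hX : X ≠ 0) : ∃ b, IsTerminalBlock X b 1 := by
  have hne : X.support.Nonempty := Finsupp.support_nonempty_iff.2 hX
  refine ⟨X.support.max' hne, one_pos, ?_, ?_, ?_⟩
  · intro i hi
    obtain rfl : i = 0 := by omega
    exact Finsupp.mem_support_iff.1 (X.support.max'_mem hne)
  · intro i j hij hj
    obtain rfl : i = j := by omega
    exact le_rfl
  · intro x hx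
    by_contra h
    have := X.support.le_max' x (Finsupp.mem_support_iff.2 h)
    omega

namespace IsTerminalBlock

variable {X : BBSConfig κ} {b v : ℕ}

theorem le_numNonzero (h : IsTerminalBlock X b v) :
    v ≤ (carrierProcess X (b + v)).numNonzero :=
  le_numNonzero_of_block h.pos h.occupied h.nonincreasing

/-- To the right of the last ball the carrier just unloads its entries, largest first. -/
theorem step (h : IsTerminalBlock X b v) :
    IsTerminalBlock (BBS.step X) (b + v) (carrierProcess X (b + v)).numNonzero where
  pos := h.pos.trans_le h.le_numNonzero
  occupied i hi := by
    rwa [step_apply_of_empty h.empty, Carrier.entry_ne_zero_iff]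
  nonincreasing i j hij _ := by
    rw [step_apply_of_empty h.empty, step_apply_of_empty h.empty]
    exact (carrierProcess X (b + v)).antitone hij
  empty x hx := by
    obtain ⟨i, rfl⟩ := Nat.exists_eq_add_of_le (show b + v ≤ x by omega)
    rw [step_apply_of_empty h.empty]
    by_contra h'
    rw [← ne_eq, Carrier.entry_ne_zero_iff] at h'
    omega

/-- The `i` earlier balls of the block force position at least `i`; a later position would leave
more than `v` entries after the remaining `v - i` insertions. -/
theorem count_eq (h : IsTerminalBlock X b v)
    (hv : (carrierProcess X (b + v)).numNonzero = v) {i : ℕ} (hi : i < v) :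
    (carrierProcess X (b + i)).count (X (b + i)) = i := by
  have hlow : i ≤ (carrierProcess X (b + i)).count (X (b + i)) := by
    rcases Nat.eq_zero_or_pos i with rfl | hi0
    · exact Nat.zero_le _
    · obtain ⟨j, rfl⟩ : ∃ j, i = j + 1 := ⟨i - 1, by omega⟩
      have h1 := count_add_lt_count_of_block h.occupied h.nonincreasing j (by omega)
      have h2 := (carrierProcess X (b + (j + 1))).count_antitone
        ((ne_zero_iff_one_le_val _).1 (h.occupied (j + 1) hi))
        (Fin.le_def.1 (h.nonincreasing j (j + 1) (by omega) hi))
      rw [← Nat.add_assoc] at h2 ⊢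
      omega
  have hup := count_add_lt_count_of_block (X := X) (a := b + i) (k := v - i)
    (fun j hj => by rw [Nat.add_assoc]; exact h.occupied _ (by omega))
    (fun j l hjl hl => by
      rw [Nat.add_assoc, Nat.add_assoc]
      exact h.nonincreasing _ _ (by omega) (by omega)) (v - i - 1) (by omega)
  have h3 := (carrierProcess X (b + v)).count_antitone one_pos
    ((ne_zero_iff_one_le_val _).1 (h.occupied (v - 1) (by have := h.pos; omega)))
  rw [← Carrier.numNonzero_eq_count, hv] at h3
  rw [show b + i + (v - i - 1) + 1 = b + v by omega,
    show b + i + (v - i - 1) = b + (v - 1) by omega] at hup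
  omega

theorem entry_carrier_after (h : IsTerminalBlock X b v)
    (hv : (carrierProcess X (b + v)).numNonzero = v) {i : ℕ} (hi : i ≤ v) (j : ℕ) :
    (carrierProcess X (b + i)).entry j =
      if j < i then X (b + j) else (carrierProcess X b).entry j := by
  induction i with
  | zero => simp
  | succ i ih =>
    rw [← Nat.add_assoc, carrierProcess, circularExclusion, dif_neg (h.occupied i hi)]
    simp only [Carrier.insert, Carrier.entrySite_eq_count]
    rw [h.count_eq hv hi, Function.update_apply, ih (by omega)]
    rcases lt_trichotomy j i with h1 | rfl | h1
    · simp [h1, h1.ne, Nat.lt_succ_of_lt h1]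
    · simp
    · rw [if_neg h1.ne', if_neg (by omega), if_neg (by omega)]

/-- If the carrier holds `v` balls after the terminal block of length `v`, then the block moves
by `v` sites in a time step, and the other balls move as if the block were absent. -/
theorem step_of_numNonzero_eq (h : IsTerminalBlock X b v)
    (hv : (carrierProcess X (b + v)).numNonzero = v) {Y : BBSConfig κ}
    (hYX : ∀ x < b, X x = Y x) (hY : ∀ x ≥ b, Y x = 0) :
    (∀ i < v, BBS.step X (b + v + i) = X (b + i)) ∧
      (∀ x < b + v, BBS.step X x = BBS.step Y x) ∧ ∀ x ≥ b + v, BBS.step Y x = 0 := by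
  refine ⟨fun i hi => ?_, fun x hx => ?_, fun x hx => ?_⟩
  · rw [step_apply_of_empty h.empty, h.entry_carrier_after hv le_rfl, if_pos hi]
  · rcases lt_or_ge x b with hxb | hxb
    · exact step_apply_congr fun y hy => hYX y (by omega)
    · obtain ⟨i, rfl⟩ := Nat.exists_eq_add_of_le hxb
      have hi : i < v := by omega
      rw [step_apply_of_empty hY, step_apply, dropped, circularExclusion,
        dif_neg (h.occupied i hi)]
      simp only [Carrier.entrySite_eq_count]
      -- Ball `i` of the block evicts entry `i` of the carrier at `b`, which is what an empty site
      -- `b + i` would have received.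
      rw [h.count_eq hv hi, h.entry_carrier_after hv hi.le, if_neg (lt_irrefl i),
        carrierProcess_congr hYX]
  · obtain ⟨i, rfl⟩ := Nat.exists_eq_add_of_le (show b ≤ x by omega)
    rw [step_apply_of_empty hY, ← carrierProcess_congr hYX]
    have h1 := h.entry_carrier_after hv le_rfl i
    rw [if_neg (by omega)] at h1
    rw [← h1]
    by_contra h2
    rw [← ne_eq, Carrier.entry_ne_zero_iff] at h2
    omega

end IsTerminalBlock

/-- A terminal block of maximal length over all times of the trajectory is a soliton, and the
other balls move as if it were absent. -/
theorem trajectory_of_maximal_block {X Y : BBSConfig κ} {b v : ℕ} (h : IsTerminalBlock X b v)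
    (hmax : ∀ t b' v', IsTerminalBlock (trajectory X t) b' v' → v' ≤ v)
    (hYX : ∀ x < b, X x = Y x) (hY : ∀ x ≥ b, Y x = 0) (t : ℕ) :
    IsTerminalBlock (trajectory X t) (b + t * v) v ∧
      (∀ i < v, trajectory X t (b + t * v + i) = X (b + i)) ∧
      (∀ x < b + t * v, trajectory X t x = trajectory Y t x) ∧
      ∀ x ≥ b + t * v, trajectory Y t x = 0 := by
  induction t with
  | zero => simpa [trajectory] using ⟨h, hYX, hY⟩
  | succ t ih =>
    obtain ⟨h1, h2, h3, h4⟩ := ih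
    have h5 := h1.step
    -- The next terminal block has the length of the carrier load, which maximality bounds by `v`.
    have hv : (carrierProcess (trajectory X t) (b + t * v + v)).numNonzero = v := by
      refine le_antisymm (hmax (t + 1) (b + t * v + v) _ ?_) h1.le_numNonzero
      rw [trajectory_succ]
      exact h5
    rw [hv] at h5
    obtain ⟨h6, h7, h8⟩ := h1.step_of_numNonzero_eq hv h3 h4
    rw [Nat.succ_mul, ← Nat.add_assoc, trajectory_succ, trajectory_succ]
    exact ⟨h5, fun i hi => (h6 i hi).trans (h2 i hi), h7, h8⟩

/-! ### Existence of the soliton decomposition -/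

theorem IsSolitonDecomposition.concat {X Y : BBSConfig κ} {S : List (ℕ × ℕ)} {b v : ℕ}
    (hS : IsSolitonDecomposition Y S) (h : IsTerminalBlock X b v)
    (hX : ∀ t, ∀ i < v, trajectory X t (b + t * v + i) = X (b + i))
    (hYX : ∀ t, ∀ x < b + t * v, trajectory X t x = trajectory Y t x)
    (hY : ∀ t, ∀ x ≥ b + t * v, trajectory Y t x = 0) :
    IsSolitonDecomposition X (S ++ [(b, v)]) := by
  have hlt : ∀ t x, trajectory Y t x ≠ 0 → x < b + t * v := by
    intro t x hx
    by_contra h'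
    exact hx (hY t x (not_lt.1 h'))
  have heq : ∀ t x, trajectory Y t x ≠ 0 → trajectory X t x = trajectory Y t x :=
    fun t x hx => hYX t x (hlt t x hx)
  have heq0 : ∀ x, Y x ≠ 0 → X x = Y x := heq 0
  refine ⟨?_, ?_, ?_⟩
  · intro p hp
    rcases List.mem_append.1 hp with hp | hp
    · have hs := hS.isSoliton p hp
      refine ⟨hs.pos, ?_, ?_, ?_⟩
      · intro i hi
        rw [heq0 _ (hs.occupied i hi)]
        exact hs.occupied i hi
      · intro i j hij hj
        rw [heq0 _ (hs.occupied i (by omega)), heq0 _ (hs.occupied j hj)]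
        exact hs.nonincreasing i j hij hj
      · intro t i hi
        have h1 := hs.preserved t i hi
        rw [heq0 _ (hs.occupied i hi), ← h1]
        exact heq t _ (h1 ▸ hs.occupied i hi)
    · obtain rfl : p = (b, v) := by simpa using hp
      exact ⟨h.pos, h.occupied, h.nonincreasing, hX⟩
  · refine List.pairwise_append.2 ⟨hS.ordered, List.pairwise_singleton _ _, ?_⟩
    intro p hp q hq
    obtain rfl : q = (b, v) := by simpa using hq
    have hs := hS.isSoliton p hp
    have hpos := hs.pos
    refine ⟨?_, ?_⟩
    · have := hlt 0 _ (hs.occupied (p.2 - 1) (by omega))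
      simp only [Nat.zero_mul] at this ⊢
      omega
    · by_contra hlen
      -- A soliton of length at least `v + 1` gains at least one site per step on the block, hence
      -- `b + 1` sites in `b + 1` steps; it would then no longer be to its left.
      have h1 := hs.preserved (b + 1) 0 hpos
      have h2 := hlt (b + 1) _ (h1 ▸ hs.occupied 0 hpos)
      have h3 : (b + 1) * (v + 1) ≤ (b + 1) * p.2 := Nat.mul_le_mul_left _ (by simpa using hlen)
      rw [Nat.mul_succ] at h3
      omega
  · intro x hx
    by_cases hYx : Y x = 0
    · refine ⟨(b, v), by simp, ?_, ?_⟩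
      · by_contra hb
        refine hx ((hYX 0 x ?_).trans hYx)
        simpa using hb
      · by_contra hb
        exact hx (h.empty x (by simpa using hb))
    · obtain ⟨p, hp, hpx⟩ := hS.covers x hYx
      exact ⟨p, by simp [hp], hpx⟩

/-- Strong induction on the number of balls. The length of a terminal block is at most the number of
balls at that time, which never exceeds the initial one, so a maximal block over all times exists
and can be removed. -/
theorem exists_isSolitonDecomposition (X : BBSConfig κ) :
    ∃ T S, IsSolitonDecomposition (trajectory X T) S := by
  induction hn : X.support.card using Nat.strong_induction_on generalizing X with
  | _ n ih =>
    rcases eq_or_ne X 0 with rfl | hX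
    · exact ⟨0, [], by simp, by simp, fun x hx => absurd rfl hx⟩
    set V : Set ℕ := {v | ∃ t b, IsTerminalBlock (trajectory X t) b v} with hV
    have hVne : V.Nonempty := by
      obtain ⟨b, hb⟩ := exists_isTerminalBlock hX
      exact ⟨1, 0, b, hb⟩
    have hVb : BddAbove V := by
      refine ⟨X.support.card, ?_⟩
      rintro v ⟨t, b, hb⟩
      exact hb.le_numNonzero.trans
        ((numNonzero_le_card_support _ _).trans (card_support_trajectory_le X t))
    obtain ⟨t₀, b, hb⟩ := Nat.sSup_mem hVne hVb
    set v := sSup V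
    have hmax : ∀ t b' v', IsTerminalBlock (trajectory (trajectory X t₀) t) b' v' → v' ≤ v := by
      intro t b' v' h
      refine le_csSup hVb ⟨t₀ + t, b', ?_⟩
      rwa [trajectory_add]
    set Z := trajectory X t₀ with hZ
    set Y : BBSConfig κ := Z.filter (· < b) with hYdef
    have hYX : ∀ x < b, Z x = Y x := fun x hx => (Finsupp.filter_apply_pos (· < b) Z hx).symm
    have hY : ∀ x ≥ b, Y x = 0 := fun x hx => Finsupp.filter_apply_neg (· < b) Z (not_lt.2 hx)
    have hcard : Y.support.card < n := by
      have h1 : Y.support.card < Z.support.card := by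
        refine Finset.card_lt_card ((Finset.ssubset_iff_of_subset ?_).2 ⟨b, ?_, ?_⟩)
        · rw [hYdef, Finsupp.support_filter]
          exact Finset.filter_subset _ _
        · exact Finsupp.mem_support_iff.2 (hb.occupied 0 hb.pos)
        · simp [hY b le_rfl]
      exact h1.trans_le (hn ▸ card_support_trajectory_le X t₀)
    obtain ⟨T, S, hS⟩ := ih _ hcard Y rfl
    have key := trajectory_of_maximal_block hb hmax hYX hY
    refine ⟨t₀ + T, S ++ [(b + T * v, v)], ?_⟩
    rw [trajectory_add, ← hZ]
    have hadd : ∀ t, b + (T + t) * v = b + T * v + t * v := fun t => by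
      rw [Nat.add_mul, Nat.add_assoc]
    refine hS.concat (key T).1 ?_ ?_ ?_
    · intro t i hi
      rw [← trajectory_add, ← hadd, (key (T + t)).2.1 i hi, (key T).2.1 i hi]
    · intro t x hx
      rw [← trajectory_add Z, ← trajectory_add Y]
      exact (key (T + t)).2.2.1 x (by rwa [hadd])
    · intro t x hx
      rw [← trajectory_add]
      exact (key (T + t)).2.2.2 x (by rwa [hadd])

/-! ### From decompositions to Young diagrams -/

theorem exists_youngDiagram_colLen {l : List ℕ} (hl : l.SortedGE) :
    ∃ μ : YoungDiagram, ∀ j, μ.colLen j = l.getD j 0 := by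
  refine ⟨(YoungDiagram.ofRowLens l hl).transpose, fun j => ?_⟩
  rw [YoungDiagram.colLen_transpose]
  by_cases hj : j < l.length
  · rw [List.getD_eq_getElem _ _ hj]
    exact YoungDiagram.rowLen_ofRowLens ⟨j, hj⟩
  · rw [List.getD_eq_default _ _ (not_lt.1 hj)]
    by_contra h
    have := YoungDiagram.mem_iff_lt_rowLen.2 (Nat.pos_of_ne_zero h)
    rw [YoungDiagram.mem_ofRowLens] at this
    exact hj this.1

theorem exists_isSolitonDiagram (X : BBSConfig κ) : ∃ Λ : YoungDiagram, IsSolitonDiagram X Λ := by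
  obtain ⟨T, S, hS⟩ := exists_isSolitonDecomposition X
  obtain ⟨Λ, hΛ⟩ := exists_youngDiagram_colLen (l := (S.map Prod.snd).reverse)
    (List.Pairwise.sortedGE (by
      rw [List.pairwise_reverse, List.pairwise_map]
      exact hS.ordered.imp fun h => h.2))
  exact ⟨Λ, T, S, hS, hΛ⟩

end BBS

/-- The trajectory started from `X₀` has a soliton Young diagram `Λ(X₀)`, and the length of its
first column (the length `λ_1(X₀)` of the longest soliton) is the maximum over `s ≥ 0` of the
number of nonzero entries of the infinite capacity carrier `Γ_s` over `X₀`. -/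
theorem lemma2p2 (κ : ℕ) (X₀ : BBSConfig κ) :
    (∃ Λ : YoungDiagram, BBS.IsSolitonDiagram X₀ Λ) ∧
      ∀ Λ : YoungDiagram, BBS.IsSolitonDiagram X₀ Λ →
        IsGreatest (Set.range fun s : ℕ => (BBS.carrierProcess X₀ s).numNonzero)
          (Λ.colLen 0) := by
  refine ⟨BBS.exists_isSolitonDiagram X₀, ?_⟩
  rintro Λ ⟨T, S, hS, hΛ⟩
  rw [hΛ 0, ← BBS.isGreatest_numNonzero_trajectory X₀ T]
  exact hS.isGreatest
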